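/- Let $X$ be a finite abstract simplicial complex on a finite vertex set $V$ (every $\{v\}$, $v\in V$, is a simplex of $X$, and so is $\emptyset$), and assume that $X$ is not the full simplex on a nonempty vertex set. A missing face of $X$ is a set $\tau\subseteq V$ with $\tau\notin X$ such that every proper subset of $\tau$ belongs to $X$; its dimension is $|\tau|-1$. Let $D(X)$ be the set of dimensions of the missing faces of $X$ (so $r\ge 1$ for all $r\in D(X)$), and let $S(X)=\bigcup_{r\in D(X)}\binom{V}{r-1}$. A vector representation $P$ of $X$ is a family of maps $P_\sigma:V\to\mathbb{R}^{\ell_\sigma}$, $\sigma\in S(X)$, such that for all $\sigma\in S(X)$ and $v,w\in V$ one has $P_\sigma(v)\cdot P_\sigma(w)\ge 0$, and $P_\sigma(v)\cdot P_\sigma(w)\ge 1$ whenever $v\neq w$, $v,w\notin\sigma$ and $\sigma\cup\{v,w\}$ is a missing face of $X$. A family of nonnegative functions $\alpha_\sigma:V\to\mathbb{R}_{\ge0}$, $\sigma\in S(X)$, is dominating for $P$ if $\sum_{\sigma\in S(X)}\sum_{v\in V}\alpha_\sigma(v)\,P_\sigma(v)\cdot P_\sigma(w)\ge 1$ for every $w\in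 V$. The value $|P|\in[0,\infty]$ is the infimum of $\sum_{\sigma\in S(X)}\sum_{v\in V}\alpha_\sigma(v)$ over all dominating families ($\infty$ if there are none), and the vector domination number of $X$ is $\Gamma(X)=\sup_P|P|\in[0,\infty]$, the supremum over all vector representations of $X$. The homological connectivity of $X$ is $\eta(X)=1+\min\{j\ge -1:\tilde H_j(X;\mathbb{R})\ne 0\}$, with $\eta(X)=\infty$ if all reduced homology groups vanish. Set $\binom{\infty}{r}=\infty$ for $r\ge 1$. Then $$\Gamma(X)\le\sum_{r\in D(X)} r\binom{\eta(X)}{r}.$$ -/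

import Mathlib

open scoped ENNReal

noncomputable section

namespace VectorDomination

/-- The simplices of `X`, including the empty one (Mathlib's `AbstractSimplicialComplex`
records only the nonempty simplices, and contains every singleton). -/
def IsSimplex {V : Type*} (X : AbstractSimplicialComplex V) (σ : Finset V) : Prop :=
  σ = ∅ ∨ σ ∈ X

/-- A missing face: a set of vertices that is not a simplex while all its proper subsets are. -/
def IsMissingFace {V : Type*} (X : AbstractSimplicialComplex V) (τ : Finset V) : Prop :=
  ¬ IsSimplex X τ ∧ ∀ σ, σ ⊂ τ → IsSimplex X σ

open Classical in
/-- The set of dimensions (cardinality minus one) of the missing faces of `X`. -/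
def missingDims {V : Type*} [Fintype V] (X : AbstractSimplicialComplex V) : Finset ℕ :=
  (Finset.range (Fintype.card V)).filter fun r => ∃ τ, IsMissingFace X τ ∧ τ.card = r + 1

/-! ### Reduced simplicial homology with real coefficients -/

open Classical in
/-- The simplices of `X` with `s` vertices, i.e. of dimension `s - 1`. -/
def faces {V : Type*} [Fintype V] (X : AbstractSimplicialComplex V) (s : ℕ) :
    Finset (Finset V) :=
  Finset.univ.filter fun σ => IsSimplex X σ ∧ σ.card = s

/-- The incidence number `[σ : τ]`: it is `(-1) ^ i` if `τ` arises from `σ` by deleting its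
`i`-th vertex (counted from `0`, in increasing order), and `0` if `τ` does not arise so. -/
def incidence {V : Type*} [LinearOrder V] (σ τ : Finset V) : ℝ :=
  ∑ v ∈ σ, if σ.erase v = τ then (-1) ^ (σ.filter (· < v)).card else 0

/-- The matrix of the boundary map from chains on simplices with `s + 1` vertices to chains on
simplices with `s` vertices. For `s = 0` it is the augmentation. -/
def boundaryMatrix {V : Type*} [Fintype V] [LinearOrder V] (X : AbstractSimplicialComplex V)
    (s : ℕ) : Matrix (faces X s) (faces X (s + 1)) ℝ :=
  Matrix.of fun τ σ => incidence σ.1 τ.1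

/-- The boundary map `C_s(X; ℝ) → C_{s-1}(X; ℝ)` (subscripts are dimensions). -/
def boundary {V : Type*} [Fintype V] [LinearOrder V] (X : AbstractSimplicialComplex V) (s : ℕ) :
    (faces X (s + 1) → ℝ) →ₗ[ℝ] (faces X s → ℝ) :=
  (boundaryMatrix X s).mulVecLin

/-- The cycles among the chains on simplices with `s` vertices. -/
def cycles {V : Type*} [Fintype V] [LinearOrder V] (X : AbstractSimplicialComplex V) :
    (s : ℕ) → Submodule ℝ (faces X s → ℝ)
  | 0 => ⊤
  | s + 1 => LinearMap.ker (boundary X s)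

/-- The boundaries among the chains on simplices with `s` vertices. -/
def boundaries {V : Type*} [Fintype V] [LinearOrder V] (X : AbstractSimplicialComplex V)
    (s : ℕ) : Submodule ℝ (faces X s → ℝ) :=
  LinearMap.range (boundary X s)

/-- `ReducedHomology X s` is the reduced homology of `X` in dimension `s - 1`. -/
abbrev ReducedHomology {V : Type*} [Fintype V] [LinearOrder V]
    (X : AbstractSimplicialComplex V) (s : ℕ) : Type _ :=
  cycles X s ⧸ (boundaries X s).submoduleOf (cycles X s)

/-- The homological connectivity `η(X) = 1 + min {j ≥ -1 : H̃_j(X; ℝ) ≠ 0}`, which is `⊤` if all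
reduced homology vanishes. Here `s = j + 1`. -/
def eta {V : Type*} [Fintype V] [LinearOrder V] (X : AbstractSimplicialComplex V) : ℕ∞ :=
  ⨅ (s : ℕ) (_ : Nontrivial (ReducedHomology X s)), (s : ℕ∞)

/-! ### Vector representations and vector domination -/

open Classical in
/-- The index set of a vector representation: all sets of `r - 1` vertices, where `r` ranges over
the dimensions of missing faces of `X`. -/
def repSets {V : Type*} [Fintype V] (X : AbstractSimplicialComplex V) : Finset (Finset V) :=
  Finset.univ.filter fun σ => σ.card + 1 ∈ missingDims X

/-- A vector representation of `X`. Only the maps `vec σ` with `σ ∈ repSets X` matter. The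
cardinality condition in `one_le` says that `v`, `w` are distinct and outside `σ`. -/
structure VectorRep {V : Type*} [Fintype V] [DecidableEq V] (X : AbstractSimplicialComplex V) where
  dim : Finset V → ℕ
  vec : (σ : Finset V) → V → EuclideanSpace ℝ (Fin (dim σ))
  nonneg : ∀ σ ∈ repSets X, ∀ v w, 0 ≤ inner ℝ (vec σ v) (vec σ w)
  one_le : ∀ σ ∈ repSets X, ∀ v w, (insert v (insert w σ)).card = σ.card + 2 →
    IsMissingFace X (insert v (insert w σ)) → 1 ≤ inner ℝ (vec σ v) (vec σ w)

/-- A family `α` of nonnegative vectors `α σ ∈ ℝ^V`, `σ ∈ repSets X`, is dominating for `P` if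
`∑ σ, α_σ P_σ P_σᵀ ≥ 1` in every coordinate `w`. -/
def IsDominating {V : Type*} [Fintype V] [DecidableEq V] {X : AbstractSimplicialComplex V}
    (P : VectorRep X) (α : Finset V → V → ℝ) : Prop :=
  (∀ σ ∈ repSets X, ∀ v, 0 ≤ α σ v) ∧
    ∀ w, 1 ≤ ∑ σ ∈ repSets X, ∑ v, α σ v * inner ℝ (P.vec σ v) (P.vec σ w)

/-- The value `|P|`: the least total weight of a dominating family (`∞` if there is none). -/
def VectorRep.value {V : Type*} [Fintype V] [DecidableEq V] {X : AbstractSimplicialComplex V}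
    (P : VectorRep X) : ℝ≥0∞ :=
  ⨅ (α : Finset V → V → ℝ) (_ : IsDominating P α),
    ENNReal.ofReal (∑ σ ∈ repSets X, ∑ v, α σ v)

/-- The vector domination number `Γ(X)`. -/
def Gamma {V : Type*} [Fintype V] [DecidableEq V] (X : AbstractSimplicialComplex V) : ℝ≥0∞ :=
  ⨆ P : VectorRep X, P.value

/-- Binomial coefficients with a possibly infinite upper entry: `C(∞, 0) = 1` and `C(∞, r) = ∞`
for `r ≥ 1`. -/
def enatChoose : ℕ∞ → ℕ → ℕ∞
  | some n, r => (n.choose r : ℕ)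
  | none, 0 => 1
  | none, _ + 1 => ⊤

end VectorDomination

end

open scoped ENNReal

noncomputable section

namespace VectorDomination

/-! Linear programming duality turns a lower bound on |P| into a fractional packing: positive
weights `f` with `∑ w, f w * (P_σ(v)·P_σ(w)) ≤ 1` for all σ, v (`exists_packing`). It remains to
show that the total weight of a packing is at most N = ∑ r·C(k,r) whenever the reduced homology in
dimension k - 1 is nonzero.

Weight the vertices by s = √f. On the full simplex the weighted Laplacian is the scalar ∑ f, so
‖dφ‖² + ‖∂φ‖² = (∑ f)‖φ‖². A harmonic φ on the k-vertex simplices of X (`exists_harmonic`) has ∂φ =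
0, and dφ lives only on non-faces. There ‖dφ‖² ≤ N‖φ‖² (`sum_sq_coboundaryOp_nonfaces_le`): inside
each non-face τ only the vertices of a chosen missing face M contribute, and pairs v, w in M are
weighted using P_σ(v)·P_σ(w) ≥ 1 for σ = M \ {v, w}. The packing inequality bounds the resulting sum
for each σ ⊆ ω with |ω| = k - 1; counting these σ gives N. -/

/-! ### Creation and annihilation operators on the full exterior algebra -/

/-- The sign `(-1) ^ i`, where `i` is the number of elements of `τ` below `v`. -/
def orderSign {V : Type*} [LinearOrder V] (v : V) (τ : Finset V) : ℝ :=
  (-1) ^ (τ.filter (· < v)).card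

/-- Exterior multiplication by the vertex `v`. -/
def create {V : Type*} [LinearOrder V] (v : V) (φ : Finset V → ℝ) (τ : Finset V) : ℝ :=
  if v ∈ τ then orderSign v τ * φ (τ.erase v) else 0

/-- Contraction by the vertex `v`. -/
def annihilate {V : Type*} [LinearOrder V] (v : V) (φ : Finset V → ℝ) (τ : Finset V) : ℝ :=
  if v ∈ τ then 0 else orderSign v τ * φ (insert v τ)

section Operators

variable {V : Type*} [LinearOrder V]

lemma orderSign_mul_self (v : V) (τ : Finset V) : orderSign v τ * orderSign v τ = 1 := by
  unfold orderSign
  rw [← mul_pow]; simp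

lemma orderSign_insert (v : V) {u : V} {τ : Finset V} (hu : u ∉ τ) :
    orderSign v (insert u τ) = (if u < v then -1 else 1) * orderSign v τ := by
  unfold orderSign
  rw [Finset.filter_insert]
  split_ifs with h
  · rw [Finset.card_insert_of_notMem (by simp [hu]), pow_succ]; ring
  · simp

lemma orderSign_insert_self (v : V) (τ : Finset V) :
    orderSign v (insert v τ) = orderSign v τ := by
  unfold orderSign
  rw [Finset.filter_insert, if_neg (lt_irrefl v)]

lemma orderSign_erase_self (v : V) (τ : Finset V) :
    orderSign v (τ.erase v) = orderSign v τ := by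
  by_cases h : v ∈ τ
  · conv_rhs => rw [← Finset.insert_erase h, orderSign_insert_self]
  · rw [Finset.erase_eq_of_notMem h]

/-- Exactly one of `v < w` and `w < v` holds, so exactly one of the two signs flips. -/
lemma orderSign_exchange {v w : V} {ρ : Finset V} (hvw : v ≠ w) (hv : v ∉ ρ) (hw : w ∉ ρ) :
    orderSign v (insert w ρ) * orderSign w (insert v ρ) = -(orderSign v ρ * orderSign w ρ) := by
  rw [orderSign_insert v hw, orderSign_insert w hv]
  rcases lt_or_gt_of_ne hvw with h | h
  · rw [if_neg h.not_gt, if_pos h]; ring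
  · rw [if_pos h, if_neg h.not_gt]; ring

/-- The canonical anticommutation relation between creation and annihilation. -/
lemma create_annihilate_add (v w : V) (φ : Finset V → ℝ) (τ : Finset V) :
    create v (annihilate w φ) τ + annihilate w (create v φ) τ = if v = w then φ τ else 0 := by
  rcases eq_or_ne v w with rfl | hvw
  · rw [if_pos rfl]
    by_cases h : v ∈ τ
    · simp only [create, annihilate, h, if_true, Finset.notMem_erase, if_false,
        orderSign_erase_self, Finset.insert_erase h]
      rw [← mul_assoc, orderSign_mul_self]; ring
    · simp only [create, annihilate, h, if_false, Finset.mem_insert_self, if_true,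
        orderSign_insert_self, Finset.erase_insert h]
      rw [← mul_assoc, orderSign_mul_self]; ring
  · rw [if_neg hvw]
    by_cases hw : w ∈ τ
    · have : w ∈ τ.erase v := Finset.mem_erase.2 ⟨hvw.symm, hw⟩
      simp [create, annihilate, hw, this]
    by_cases hv : v ∈ τ
    · obtain ⟨ρ, hρ, rfl⟩ : ∃ ρ, v ∉ ρ ∧ insert v ρ = τ :=
        ⟨τ.erase v, Finset.notMem_erase _ _, Finset.insert_erase hv⟩
      have hwρ : w ∉ ρ := fun h => hw (Finset.mem_insert_of_mem h)
      have hv' : v ∉ insert w ρ := by simp [hvw, hρ]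
      have key := orderSign_exchange hvw hρ hwρ
      simp only [create, annihilate, Finset.mem_insert_self, if_true, hw, if_false,
        Finset.erase_insert hρ, hwρ, orderSign_insert_self, Finset.insert_comm w v ρ,
        Finset.erase_insert hv']
      linear_combination φ (insert w ρ) * key
    · have : v ∉ insert w τ := by simp [hvw, hv]
      simp [create, annihilate, hv, this]

lemma annihilate_anticomm (v w : V) (φ : Finset V → ℝ) (τ : Finset V) :
    annihilate v (annihilate w φ) τ = -annihilate w (annihilate v φ) τ := by
  rcases eq_or_ne v w with rfl | hvw
  · by_cases hv : v ∈ τ <;> simp [annihilate, hv]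
  by_cases hv : v ∈ τ
  · simp [annihilate, hv]
  by_cases hw : w ∈ τ
  · simp [annihilate, hw]
  have hv' : v ∉ insert w τ := by simp [hvw, hv]
  have hw' : w ∉ insert v τ := by simp [hvw.symm, hw]
  simp only [annihilate, hv, hw, hv', hw', if_false, Finset.insert_comm w v τ]
  rw [orderSign_insert v hw, orderSign_insert w hv]
  rcases lt_or_gt_of_ne hvw with h | h
  · rw [if_neg h.not_gt, if_pos h]; ring
  · rw [if_pos h, if_neg h.not_gt]; ring

lemma create_sum {ι : Type*} (t : Finset ι) (v : V) (a : ι → ℝ) (φ : ι → Finset V → ℝ)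
    (τ : Finset V) :
    create v (fun ρ => ∑ i ∈ t, a i * φ i ρ) τ = ∑ i ∈ t, a i * create v (φ i) τ := by
  unfold create
  split_ifs
  · rw [Finset.mul_sum]; exact Finset.sum_congr rfl fun i _ => by ring
  · simp

lemma annihilate_sum {ι : Type*} (t : Finset ι) (v : V) (a : ι → ℝ) (φ : ι → Finset V → ℝ)
    (τ : Finset V) :
    annihilate v (fun ρ => ∑ i ∈ t, a i * φ i ρ) τ = ∑ i ∈ t, a i * annihilate v (φ i) τ := by
  unfold annihilate
  split_ifs
  · simp
  · rw [Finset.mul_sum]; exact Finset.sum_congr rfl fun i _ => by ring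

/-! ### Adjointness and the weighted Laplacian of the full simplex -/

variable [Fintype V]

lemma sum_create_mul (v : V) (φ ψ : Finset V → ℝ) :
    ∑ τ, create v φ τ * ψ τ = ∑ τ, φ τ * annihilate v ψ τ := by
  simp only [create, annihilate, ite_mul, zero_mul, mul_ite, mul_zero]
  have h (τ : Finset V) : (if v ∈ τ then 0 else φ τ * (orderSign v τ * ψ (insert v τ))) =
      if v ∉ τ then φ τ * (orderSign v τ * ψ (insert v τ)) else 0 := (ite_not _ _ _).symm
  rw [← Finset.sum_filter, Finset.sum_congr rfl fun τ _ => h τ, ← Finset.sum_filter]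
  refine Finset.sum_nbij' (fun τ => τ.erase v) (fun τ => insert v τ) ?_ ?_ ?_ ?_ ?_
  · simp
  · simp
  · intro τ hτ; exact Finset.insert_erase (by simpa using hτ)
  · intro τ hτ; exact Finset.erase_insert (by simpa using hτ)
  · intro τ hτ
    rw [Finset.insert_erase (by simpa using hτ), orderSign_erase_self]; ring

/-- The weighted coboundary on the full simplex. -/
def coboundaryOp (s : V → ℝ) (φ : Finset V → ℝ) (τ : Finset V) : ℝ :=
  ∑ v, s v * create v φ τ

/-- The weighted boundary on the full simplex. -/
def boundaryOp (s : V → ℝ) (φ : Finset V → ℝ) (τ : Finset V) : ℝ :=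
  ∑ v, s v * annihilate v φ τ

lemma sum_coboundaryOp_mul (s : V → ℝ) (φ ψ : Finset V → ℝ) :
    ∑ τ, coboundaryOp s φ τ * ψ τ = ∑ τ, φ τ * boundaryOp s ψ τ := by
  simp only [coboundaryOp, boundaryOp, Finset.sum_mul, Finset.mul_sum]
  rw [Finset.sum_comm]
  conv_rhs => rw [Finset.sum_comm]
  refine Finset.sum_congr rfl fun v _ => ?_
  have h := congrArg (s v * ·) (sum_create_mul v φ ψ)
  simp only [Finset.mul_sum] at h
  convert h using 2 <;> ring

lemma boundaryOp_boundaryOp (s : V → ℝ) (φ : Finset V → ℝ) (τ : Finset V) :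
    boundaryOp s (boundaryOp s φ) τ = 0 := by
  have h : boundaryOp s (boundaryOp s φ) τ =
      ∑ v, ∑ w, s v * (s w * annihilate v (annihilate w φ) τ) := by
    unfold boundaryOp
    simp only [annihilate_sum, Finset.mul_sum]
  have h' : boundaryOp s (boundaryOp s φ) τ = -boundaryOp s (boundaryOp s φ) τ := by
    rw [h]
    conv_lhs => rw [Finset.sum_comm]
    simp only [← Finset.sum_neg_distrib]
    refine Finset.sum_congr rfl fun v _ => Finset.sum_congr rfl fun w _ => ?_
    rw [annihilate_anticomm]; ring
  linarith

/-- The weighted Laplacian of the full simplex is a scalar. -/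
lemma boundaryOp_coboundaryOp_add (s : V → ℝ) (φ : Finset V → ℝ) (τ : Finset V) :
    boundaryOp s (coboundaryOp s φ) τ + coboundaryOp s (boundaryOp s φ) τ =
      (∑ v, s v ^ 2) * φ τ := by
  unfold boundaryOp coboundaryOp
  simp only [annihilate_sum, create_sum, Finset.mul_sum]
  rw [Finset.sum_comm, ← Finset.sum_add_distrib, Finset.sum_mul]
  refine Finset.sum_congr rfl fun v _ => ?_
  rw [← Finset.sum_add_distrib]
  calc _ = ∑ w, s v * s w * (if v = w then φ τ else 0) := by
        refine Finset.sum_congr rfl fun w _ => ?_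
        rw [← create_annihilate_add]; ring
    _ = _ := by
        simp only [mul_ite, mul_zero, Finset.sum_ite_eq, Finset.mem_univ, if_true]; ring

lemma sum_sq_coboundaryOp_add (s : V → ℝ) (φ : Finset V → ℝ) :
    ∑ τ, coboundaryOp s φ τ ^ 2 + ∑ τ, boundaryOp s φ τ ^ 2 =
      (∑ v, s v ^ 2) * ∑ τ, φ τ ^ 2 := by
  simp only [sq (coboundaryOp _ _ _), sq (boundaryOp _ _ _)]
  rw [sum_coboundaryOp_mul, ← sum_coboundaryOp_mul s (boundaryOp s φ) φ,
    ← Finset.sum_add_distrib, Finset.mul_sum]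
  refine Finset.sum_congr rfl fun τ _ => ?_
  linear_combination φ τ * boundaryOp_coboundaryOp_add s φ τ

/-- Each `φ τ ^ 2` is counted once for every vertex deleted from τ. -/
lemma sum_sum_sq_annihilate (φ : Finset V → ℝ) :
    ∑ ω, ∑ v, annihilate v φ ω ^ 2 = ∑ τ, (τ.card : ℝ) * φ τ ^ 2 := by
  rw [Finset.sum_comm]
  have h (v : V) : ∑ ω, annihilate v φ ω ^ 2 = ∑ τ, if v ∈ τ then φ τ ^ 2 else 0 := by
    simp only [sq (annihilate _ _ _)]
    rw [← sum_create_mul]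
    refine Finset.sum_congr rfl fun τ _ => ?_
    by_cases hv : v ∈ τ
    · simp only [create, annihilate, hv, if_true, Finset.notMem_erase, if_false,
        orderSign_erase_self, Finset.insert_erase hv]
      linear_combination φ τ ^ 2 * orderSign_mul_self v τ
    · simp [create, hv]
  rw [Finset.sum_congr rfl fun v _ => h v, Finset.sum_comm]
  refine Finset.sum_congr rfl fun τ _ => ?_
  simp

end Operators

/-! ### The contribution of the non-faces -/

section NonFaces

lemma exists_missingFace_subset {V : Type*} (X : AbstractSimplicialComplex V) {τ : Finset V}
    (hτ : ¬ IsSimplex X τ) : ∃ M ⊆ τ, IsMissingFace X M := by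
  induction τ using Finset.strongInduction with
  | H τ ih =>
    by_cases h : ∀ σ, σ ⊂ τ → IsSimplex X σ
    · exact ⟨τ, subset_rfl, hτ, h⟩
    · push Not at h
      obtain ⟨σ, hσ, hσX⟩ := h
      obtain ⟨M, hM, hMX⟩ := ih σ hσ hσX
      exact ⟨M, hM.trans hσ.subset, hMX⟩

lemma IsSimplex.mono {V : Type*} {X : AbstractSimplicialComplex V} {σ τ : Finset V}
    (hτ : IsSimplex X τ) (h : σ ⊆ τ) : IsSimplex X σ := by
  rcases σ.eq_empty_or_nonempty with rfl | hne
  · exact Or.inl rfl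
  · rcases hτ with rfl | hτ
    · exact absurd (Finset.subset_empty.1 h) hne.ne_empty
    · exact Or.inr ((X.isRelLowerSet_faces hτ).2 h hne)

lemma IsMissingFace.two_le_card {V : Type*} {X : AbstractSimplicialComplex V} {M : Finset V}
    (hM : IsMissingFace X M) : 2 ≤ M.card := by
  by_contra! h
  rcases Nat.lt_succ_iff_lt_or_eq.1 h with h | h
  · exact hM.1 (Or.inl (Finset.card_eq_zero.1 (Nat.lt_one_iff.1 h)))
  · obtain ⟨v, rfl⟩ := Finset.card_eq_one.1 h
    exact hM.1 (Or.inr (X.singleton_mem v))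

lemma one_le_of_mem_missingDims {V : Type*} [Fintype V] {X : AbstractSimplicialComplex V} {r : ℕ}
    (hr : r ∈ missingDims X) : 1 ≤ r := by
  simp only [missingDims, Finset.mem_filter] at hr
  obtain ⟨-, τ, hτ, hc⟩ := hr
  have := hτ.two_le_card
  omega

lemma IsMissingFace.card_sub_one_mem {V : Type*} [Fintype V] {X : AbstractSimplicialComplex V}
    {M : Finset V} (hM : IsMissingFace X M) : M.card - 1 ∈ missingDims X := by
  have h2 := hM.two_le_card
  have := Finset.card_le_univ M
  simp only [missingDims, Finset.mem_filter, Finset.mem_range]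
  exact ⟨by omega, M, hM, by omega⟩

/-- With m = |M|, the off-diagonal sum equals (2m - 4) ∑ y² + 2 (∑ y)², and the first term is
nonnegative as m ≥ 2. -/
lemma sq_sum_le_sum_offDiag {ι : Type*} [DecidableEq ι] (M : Finset ι) (hM : 2 ≤ M.card)
    (y : ι → ℝ) :
    (∑ v ∈ M, y v) ^ 2 ≤ 1 / 2 * ∑ p ∈ M.offDiag, (y p.1 + y p.2) ^ 2 := by
  have h1 : ∑ p ∈ M.offDiag, (y p.1 + y p.2) ^ 2 + ∑ v ∈ M, 4 * y v ^ 2 =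
      ∑ v ∈ M, ∑ w ∈ M, (y v + y w) ^ 2 := by
    rw [← Finset.sum_product', ← Finset.diag_union_offDiag,
      Finset.sum_union (Finset.disjoint_diag_offDiag M), Finset.sum_diag, add_comm]
    congr 1
    exact Finset.sum_congr rfl fun v _ => by ring
  have h2 : ∑ v ∈ M, ∑ w ∈ M, (y v + y w) ^ 2 =
      2 * (M.card : ℝ) * ∑ v ∈ M, y v ^ 2 + 2 * (∑ v ∈ M, y v) ^ 2 := by
    simp only [add_sq, Finset.sum_add_distrib, Finset.sum_const, nsmul_eq_mul, ← Finset.mul_sum,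
      ← Finset.sum_mul]
    ring
  have h3 : (2 : ℝ) ≤ M.card := by exact_mod_cast hM
  have h4 : 0 ≤ ∑ v ∈ M, y v ^ 2 := Finset.sum_nonneg fun v _ => sq_nonneg _
  rw [← Finset.mul_sum] at h1
  nlinarith

/-- Expanding the square, the mixed terms assemble to -2‖∑ s_v z_v p_v‖² ≤ 0, and the packing
hypothesis bounds each of the two remaining sums by ∑ z². -/
lemma sum_inner_mul_sq_le {V E : Type*} [Fintype V] [NormedAddCommGroup E] [InnerProductSpace ℝ E]
    (p : V → E) (s z : V → ℝ) (hs : ∀ v, ∑ w, s w ^ 2 * inner ℝ (p v) (p w) ≤ 1) :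
    ∑ v, ∑ w, inner ℝ (p v) (p w) * (s v * z w - s w * z v) ^ 2 ≤ 2 * ∑ v, z v ^ 2 := by
  have h1 : ∑ v, ∑ w, inner ℝ (p v) (p w) * (s v * z w - s w * z v) ^ 2 =
      ∑ v, ∑ w, z w ^ 2 * (s v ^ 2 * inner ℝ (p w) (p v)) +
      ∑ v, ∑ w, z v ^ 2 * (s w ^ 2 * inner ℝ (p v) (p w)) -
      2 * ∑ v, ∑ w, (s v * z v) * ((s w * z w) * inner ℝ (p v) (p w)) := by
    simp only [Finset.mul_sum, ← Finset.sum_add_distrib, ← Finset.sum_sub_distrib]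
    refine Finset.sum_congr rfl fun v _ => Finset.sum_congr rfl fun w _ => ?_
    rw [real_inner_comm (p v) (p w)]; ring
  have h2 : ∑ v, ∑ w, (s v * z v) * ((s w * z w) * inner ℝ (p v) (p w)) =
      inner ℝ (∑ v, (s v * z v) • p v) (∑ v, (s v * z v) • p v) := by
    simp only [sum_inner, inner_sum, real_inner_smul_left, real_inner_smul_right]
    refine Finset.sum_congr rfl fun v _ => Finset.sum_congr rfl fun w _ => ?_
    rw [real_inner_comm (p v) (p w)]
  have h3 : ∑ v, ∑ w, z v ^ 2 * (s w ^ 2 * inner ℝ (p v) (p w)) ≤ ∑ v, z v ^ 2 := by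
    refine Finset.sum_le_sum fun v _ => ?_
    rw [← Finset.mul_sum]
    exact mul_le_of_le_one_right (sq_nonneg _) (hs v)
  have h4 : 0 ≤ inner ℝ (∑ v, (s v * z v) • p v) (∑ v, (s v * z v) • p v) :=
    real_inner_self_nonneg
  rw [h1, Finset.sum_comm, h2]
  linarith

/-- Rewrites a pair of coboundary terms at τ through contractions at ω = τ \ {v, w}, the form to
which `sum_inner_mul_sq_le` applies. The minus sign comes from the order of v and w. -/
lemma create_pair_sq {V : Type*} [LinearOrder V] (s : V → ℝ) (φ : Finset V → ℝ) {τ : Finset V}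
    {v w : V} (hvw : v ≠ w) (hv : v ∈ τ) (hw : w ∈ τ) :
    (s v * create v φ τ + s w * create w φ τ) ^ 2 =
      (s v * annihilate w φ ((τ.erase v).erase w) -
        s w * annihilate v φ ((τ.erase v).erase w)) ^ 2 := by
  obtain ⟨ρ, hvρ, hwρ, rfl⟩ : ∃ ρ, v ∉ ρ ∧ w ∉ ρ ∧ insert v (insert w ρ) = τ := by
    refine ⟨(τ.erase v).erase w, by simp, by simp, ?_⟩
    rw [Finset.insert_erase (Finset.mem_erase.2 ⟨hvw.symm, hw⟩), Finset.insert_erase hv]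
  have hv' : v ∉ insert w ρ := by simp [hvw, hvρ]
  have hw' : w ∉ insert v ρ := by simp [hvw.symm, hwρ]
  have e : (insert v (insert w ρ)).erase w = insert v ρ := by
    rw [Finset.insert_comm, Finset.erase_insert hw']
  have key : orderSign w (insert v (insert w ρ)) = orderSign w (insert v ρ) := by
    rw [Finset.insert_comm, orderSign_insert_self]
  simp only [create, annihilate, hv, hw, if_true, Finset.erase_insert hv', Finset.erase_insert hwρ,
    e, hvρ, hwρ, if_false, key, orderSign_insert_self]
  have h1 := orderSign_mul_self v ρ
  have h2 := orderSign_mul_self w ρ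
  rw [orderSign_insert v hwρ, orderSign_insert w hvρ]
  generalize orderSign v ρ = a at *
  generalize orderSign w ρ = b at *
  -- Since a² = b² = 1, the square depends only on the product ab, so a and b may be exchanged.
  have e1 : ∀ x y : ℝ, (s v * (a * x) - s w * (b * y)) ^ 2 =
      (s v * (b * x) - s w * (a * y)) ^ 2 := fun x y => by
    linear_combination (s v ^ 2 * x ^ 2 - s w ^ 2 * y ^ 2) * (h1 - h2)
  rcases lt_or_gt_of_ne hvw with h | h
  · rw [if_neg h.not_gt, if_pos h, ← e1]; ring
  · rw [if_pos h, if_neg h.not_gt, ← e1]; ring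

variable {V : Type*} [Fintype V] [LinearOrder V] {X : AbstractSimplicialComplex V}

/-- The subsets of ω in question have sizes r - 1, distinct for distinct r; then k·C(k-1, r-1) =
r·C(k, r). -/
lemma sum_card_repSets_subsets {k : ℕ} {ω : Finset V} (hω : ω.card + 1 = k) :
    k * (ω.powerset.filter (· ∈ repSets X)).card = ∑ r ∈ missingDims X, r * k.choose r := by
  have h : ω.powerset.filter (· ∈ repSets X) =
      (missingDims X).biUnion fun r => ω.powersetCard (r - 1) := by
    ext σ
    simp only [repSets, Finset.mem_filter, Finset.mem_powerset, Finset.mem_univ, true_and,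
      Finset.mem_biUnion, Finset.mem_powersetCard]
    constructor
    · rintro ⟨h1, h2⟩
      exact ⟨_, h2, h1, by simp⟩
    · rintro ⟨r, hr, h1, h2⟩
      have := one_le_of_mem_missingDims hr
      refine ⟨h1, ?_⟩
      rwa [h2, Nat.sub_add_cancel this]
  rw [h, Finset.card_biUnion, Finset.mul_sum]
  · refine Finset.sum_congr rfl fun r hr => ?_
    obtain ⟨q, rfl⟩ := Nat.exists_eq_add_of_le' (one_le_of_mem_missingDims hr)
    subst hω
    rw [Finset.card_powersetCard, Nat.add_sub_cancel, Nat.add_one_mul_choose_eq, mul_comm]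
  · intro r hr r' hr' hne
    refine Finset.disjoint_left.2 fun σ h1 h2 => hne ?_
    have h1 := (Finset.mem_powersetCard.1 h1).2
    have h2 := (Finset.mem_powersetCard.1 h2).2
    have := one_le_of_mem_missingDims hr
    have := one_le_of_mem_missingDims hr'
    omega

lemma sum_pairs_le (P : VectorRep X) (s : V → ℝ) {k : ℕ} (φ : Finset V → ℝ)
    (hk : ∀ σ, φ σ ≠ 0 → σ.card = k)
    (hs : ∀ σ ∈ repSets X, ∀ v, ∑ w, s w ^ 2 * inner ℝ (P.vec σ v) (P.vec σ w) ≤ 1) :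
    ∑ ω with ω.card + 1 = k, ∑ σ ∈ ω.powerset with σ ∈ repSets X, ∑ v, ∑ w,
      inner ℝ (P.vec σ v) (P.vec σ w) *
        (s v * annihilate w φ ω - s w * annihilate v φ ω) ^ 2 ≤
      2 * ((∑ r ∈ missingDims X, r * k.choose r : ℕ) : ℝ) * ∑ τ, φ τ ^ 2 := by
  set N := ∑ r ∈ missingDims X, r * k.choose r with hN
  -- For k = 0 there is no ω; otherwise division by k is allowed below.
  rcases k.eq_zero_or_pos with rfl | hkpos
  · simp only [Nat.add_eq_zero_iff, one_ne_zero, and_false, Finset.filter_false, Finset.sum_empty]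
    have : 0 ≤ ∑ τ, φ τ ^ 2 := Finset.sum_nonneg fun _ _ => sq_nonneg _
    positivity
  have hk0 : (0 : ℝ) < k := by exact_mod_cast hkpos
  have h0 (ω : Finset V) : 0 ≤ ∑ v, annihilate v φ ω ^ 2 :=
    Finset.sum_nonneg fun _ _ => sq_nonneg _
  calc _ ≤ ∑ ω with ω.card + 1 = k, ∑ σ ∈ ω.powerset with σ ∈ repSets X,
          2 * ∑ v, annihilate v φ ω ^ 2 := by
        refine Finset.sum_le_sum fun ω _ => Finset.sum_le_sum fun σ hσ => ?_
        exact sum_inner_mul_sq_le _ s _ (hs σ (Finset.mem_filter.1 hσ).2)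
    _ = ∑ ω with ω.card + 1 = k, 2 * (N / k : ℝ) * ∑ v, annihilate v φ ω ^ 2 := by
        refine Finset.sum_congr rfl fun ω hω => ?_
        have h := sum_card_repSets_subsets (X := X) (Finset.mem_filter.1 hω).2
        rw [← hN] at h
        rw [Finset.sum_const, nsmul_eq_mul, ← h]
        push_cast
        field_simp
    _ ≤ ∑ ω, 2 * (N / k : ℝ) * ∑ v, annihilate v φ ω ^ 2 :=
        Finset.sum_le_sum_of_subset_of_nonneg (Finset.subset_univ _) fun ω _ _ =>
          mul_nonneg (by positivity) (h0 ω)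
    _ = 2 * (N / k : ℝ) * ∑ τ, (τ.card : ℝ) * φ τ ^ 2 := by
        rw [← Finset.mul_sum, sum_sum_sq_annihilate]
    _ = 2 * (N / k : ℝ) * ∑ τ, (k : ℝ) * φ τ ^ 2 := by
        congr 1
        refine Finset.sum_congr rfl fun τ _ => ?_
        by_cases h : φ τ = 0
        · simp [h]
        · rw [hk τ h]
    _ = _ := by rw [← Finset.mul_sum]; field_simp

/-- The coboundary of a cochain of `X`, taken in the full simplex, has small norm on the
non-faces of `X`. -/
lemma sum_sq_coboundaryOp_nonfaces_le (P : VectorRep X) (s : V → ℝ) {k : ℕ} (φ : Finset V → ℝ)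
    (hk : ∀ σ, φ σ ≠ 0 → IsSimplex X σ ∧ σ.card = k)
    (hs : ∀ σ ∈ repSets X, ∀ v, ∑ w, s w ^ 2 * inner ℝ (P.vec σ v) (P.vec σ w) ≤ 1)
    (T : Finset (Finset V)) (hT : ∀ τ ∈ T, ¬ IsSimplex X τ ∧ τ.card = k + 1) :
    ∑ τ ∈ T, coboundaryOp s φ τ ^ 2 ≤
      ((∑ r ∈ missingDims X, r * k.choose r : ℕ) : ℝ) * ∑ τ, φ τ ^ 2 := by
  choose! M hMsub hM using fun τ (hτ : ¬ IsSimplex X τ) => exists_missingFace_subset X hτ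
  let G (q : Σ _ : Finset V, Σ _ : Finset V, V × V) : ℝ :=
    inner ℝ (P.vec q.2.1 q.2.2.1) (P.vec q.2.1 q.2.2.2) *
      (s q.2.2.1 * annihilate q.2.2.2 φ q.1 - s q.2.2.2 * annihilate q.2.2.1 φ q.1) ^ 2
  -- Sends (τ, v, w) to (τ \ {v, w}, M \ {v, w}, v, w). Keeping v and w in the image makes this
  -- injective: putting them back recovers τ.
  let F (q : Σ _ : Finset V, V × V) : Σ _ : Finset V, Σ _ : Finset V, V × V :=
    ⟨(q.1.erase q.2.1).erase q.2.2, ((M q.1).erase q.2.1).erase q.2.2, q.2⟩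
  let S : Finset (Σ _ : Finset V, V × V) := T.sigma fun τ => (M τ).offDiag
  let R : Finset (Σ _ : Finset V, Σ _ : Finset V, V × V) :=
    (Finset.univ.filter fun ω : Finset V => ω.card + 1 = k).sigma fun ω =>
      (ω.powerset.filter (· ∈ repSets X)).sigma fun _ => Finset.univ
  have hSq : ∀ q ∈ S, (¬ IsSimplex X q.1 ∧ q.1.card = k + 1) ∧ IsMissingFace X (M q.1) ∧
      M q.1 ⊆ q.1 ∧ q.2.1 ∈ M q.1 ∧ q.2.2 ∈ M q.1 ∧ q.2.1 ≠ q.2.2 := by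
    intro q hq
    obtain ⟨h1, h2⟩ := Finset.mem_sigma.1 hq
    have h3 := hT _ h1
    exact ⟨h3, hM _ h3.1, hMsub _ h3.1, Finset.mem_offDiag.1 h2⟩
  have hcard : ∀ (τ : Finset V) (v w : V), v ∈ τ → w ∈ τ → v ≠ w →
      ((τ.erase v).erase w).card + 2 = τ.card := by
    intro τ v w hv hw hvw
    have hw' : w ∈ τ.erase v := Finset.mem_erase.2 ⟨hvw.symm, hw⟩
    have := Finset.card_erase_add_one hw'
    have := Finset.card_erase_add_one hv
    omega
  have hins : ∀ (τ : Finset V) (v w : V), v ∈ τ → w ∈ τ → v ≠ w →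
      insert v (insert w ((τ.erase v).erase w)) = τ := by
    intro τ v w hv hw hvw
    rw [Finset.insert_erase (Finset.mem_erase.2 ⟨hvw.symm, hw⟩), Finset.insert_erase hv]
  have hrep : ∀ q ∈ S, ((M q.1).erase q.2.1).erase q.2.2 ∈ repSets X := by
    intro q hq
    obtain ⟨-, h2, -, h4, h5, h6⟩ := hSq q hq
    have := hcard _ _ _ h4 h5 h6
    have h7 := h2.card_sub_one_mem
    simp only [repSets, Finset.mem_filter, Finset.mem_univ, true_and]
    convert h7 using 1
    omega
  have hGnonneg : ∀ q ∈ R, 0 ≤ G q := by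
    intro q hq
    simp only [R, Finset.mem_sigma, Finset.mem_filter] at hq
    exact mul_nonneg (P.nonneg _ hq.2.1.2 _ _) (sq_nonneg _)
  have hinj : Set.InjOn F S := by
    rintro ⟨τ, v, w⟩ hq ⟨τ', v', w'⟩ hq' h
    obtain ⟨-, -, h3, h4, h5, h6⟩ := hSq _ hq
    obtain ⟨-, -, h3', h4', h5', h6'⟩ := hSq _ hq'
    simp only [F, Sigma.mk.injEq, heq_eq_eq, Prod.mk.injEq] at h
    obtain ⟨e1, e2, rfl, rfl⟩ := h
    have := hins τ v w (h3 h4) (h3 h5) h6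
    rw [e1, hins τ' v w (h3' h4') (h3' h5') h6'] at this
    subst this
    rfl
  have hsub : S.image F ⊆ R := by
    intro q hq
    obtain ⟨p, hp, rfl⟩ := Finset.mem_image.1 hq
    obtain ⟨h1, -, h3, h4, h5, h6⟩ := hSq p hp
    simp only [R, F, Finset.mem_sigma, Finset.mem_filter, Finset.mem_univ, true_and, and_true,
      Finset.mem_powerset]
    refine ⟨?_, Finset.erase_subset_erase _ (Finset.erase_subset_erase _ h3), hrep p hp⟩
    have := hcard _ _ _ (h3 h4) (h3 h5) h6
    omega
  have hterm : ∀ q ∈ S, (s q.2.1 * create q.2.1 φ q.1 + s q.2.2 * create q.2.2 φ q.1) ^ 2 ≤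
      G (F q) := by
    intro q hq
    obtain ⟨-, h2, h3, h4, h5, h6⟩ := hSq q hq
    rw [create_pair_sq s φ h6 (h3 h4) (h3 h5)]
    refine le_mul_of_one_le_left (sq_nonneg _) (P.one_le _ (hrep q hq) _ _ ?_ ?_)
    · rw [hins _ _ _ h4 h5 h6, hcard _ _ _ h4 h5 h6]
    · rwa [hins _ _ _ h4 h5 h6]
  -- If v ∉ M, then τ \ {v} still contains M, so it is not a simplex and φ vanishes on it.
  have hcob : ∀ τ ∈ T, coboundaryOp s φ τ = ∑ v ∈ M τ, s v * create v φ τ := by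
    intro τ hτ
    symm
    refine Finset.sum_subset (Finset.subset_univ _) fun v _ hv => ?_
    unfold create
    split_ifs with hvτ
    · have : φ (τ.erase v) = 0 := by
        by_contra h
        refine (hM τ (hT τ hτ).1).1 ((hk _ h).1.mono fun u hu => Finset.mem_erase.2 ⟨?_, ?_⟩)
        · rintro rfl; exact hv hu
        · exact hMsub τ (hT τ hτ).1 hu
      rw [this]; ring
    · ring
  calc ∑ τ ∈ T, coboundaryOp s φ τ ^ 2
      ≤ ∑ τ ∈ T, 1 / 2 * ∑ p ∈ (M τ).offDiag,
          (s p.1 * create p.1 φ τ + s p.2 * create p.2 φ τ) ^ 2 := by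
        refine Finset.sum_le_sum fun τ hτ => ?_
        rw [hcob τ hτ]
        exact sq_sum_le_sum_offDiag (M τ) (hM τ (hT τ hτ).1).two_le_card
          fun v => s v * create v φ τ
    _ = 1 / 2 * ∑ q ∈ S, (s q.2.1 * create q.2.1 φ q.1 + s q.2.2 * create q.2.2 φ q.1) ^ 2 := by
        rw [← Finset.mul_sum, Finset.sum_sigma]
    _ ≤ 1 / 2 * ∑ q ∈ S, G (F q) := by
        gcongr with q hq; exact hterm q hq
    _ = 1 / 2 * ∑ q ∈ S.image F, G q := by rw [Finset.sum_image hinj]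
    _ ≤ 1 / 2 * ∑ q ∈ R, G q := by
        gcongr 1 / 2 * ?_
        exact Finset.sum_le_sum_of_subset_of_nonneg hsub fun q hq _ => hGnonneg q hq
    _ ≤ 1 / 2 * (2 * ((∑ r ∈ missingDims X, r * k.choose r : ℕ) : ℝ) * ∑ τ, φ τ ^ 2) := by
        gcongr 1 / 2 * ?_
        refine le_trans (le_of_eq ?_) (sum_pairs_le P s φ (fun σ h => (hk σ h).2) hs)
        simp only [R, Finset.sum_sigma, G, Fintype.sum_prod_type]
    _ = _ := by ring

end NonFaces

/-! ### Harmonic representatives of reduced homology classes -/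

section Homology

lemma mem_faces {V : Type*} [Fintype V] {X : AbstractSimplicialComplex V} {k : ℕ} {σ : Finset V} :
    σ ∈ faces X k ↔ IsSimplex X σ ∧ σ.card = k := by
  simp [faces]

variable {V : Type*} [Fintype V] [LinearOrder V]

lemma sum_incidence_mul (g : Finset V → ℝ) (τ : Finset V) :
    ∑ σ, incidence σ τ * g σ = ∑ v, annihilate v g τ := by
  have h (σ : Finset V) : incidence σ τ * g σ =
      ∑ v, if v ∈ σ ∧ σ.erase v = τ then orderSign v σ * g σ else 0 := by
    rw [incidence, Finset.sum_mul, ← Finset.sum_filter, ← Finset.filter_filter,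
      Finset.sum_filter (fun v => σ.erase v = τ), Finset.filter_univ_mem]
    exact Finset.sum_congr rfl fun v _ => by rw [ite_mul, zero_mul, orderSign]
  rw [Finset.sum_congr rfl fun σ _ => h σ, Finset.sum_comm]
  refine Finset.sum_congr rfl fun v _ => ?_
  unfold annihilate
  split_ifs with hv
  · refine Finset.sum_eq_zero fun σ _ => if_neg ?_
    rintro ⟨-, rfl⟩
    exact Finset.notMem_erase _ _ hv
  · rw [Finset.sum_eq_single (insert v τ)]
    · rw [if_pos ⟨Finset.mem_insert_self _ _, Finset.erase_insert hv⟩, orderSign_insert_self]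
    · rintro σ - hσ
      refine if_neg ?_
      rintro ⟨h1, rfl⟩
      exact hσ (Finset.insert_erase h1).symm
    · simp

/-- Extension by zero of a chain of `X` to the full simplex, rescaled by vertex weights. -/
def weightedExtend (X : AbstractSimplicialComplex V) (s : V → ℝ) (k : ℕ) :
    (faces X k → ℝ) →ₗ[ℝ] (Finset V → ℝ) where
  toFun c σ := (if h : σ ∈ faces X k then c ⟨σ, h⟩ else 0) * (∏ v ∈ σ, s v)⁻¹
  map_add' c d := by
    ext σ
    by_cases h : σ ∈ faces X k <;> simp [h, add_mul]
  map_smul' a c := by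
    ext σ
    by_cases h : σ ∈ faces X k <;> simp [h, mul_assoc]

variable {X : AbstractSimplicialComplex V} {s : V → ℝ}

lemma weightedExtend_apply (k : ℕ) (c : faces X k → ℝ) (σ : faces X k) :
    weightedExtend X s k c σ = c σ * (∏ v ∈ σ.1, s v)⁻¹ := by
  simp [weightedExtend]

lemma weightedExtend_apply_of_notMem {k : ℕ} (c : faces X k → ℝ) {σ : Finset V}
    (hσ : σ ∉ faces X k) : weightedExtend X s k c σ = 0 := by
  simp [weightedExtend, hσ]

lemma weightedExtend_injective (hs : ∀ v, 0 < s v) (k : ℕ) :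
    Function.Injective (weightedExtend X s k) := by
  intro c d h
  ext σ
  have h1 := congrFun h σ
  rw [weightedExtend_apply, weightedExtend_apply] at h1
  exact mul_right_cancel₀ (inv_ne_zero (Finset.prod_pos fun v _ => hs v).ne') h1

/-- Deleting v from a simplex removes the factor 1 / s v, which is what the weight `s v` in
`boundaryOp` compensates. Thus positive weights do not change homology. -/
lemma boundaryOp_weightedExtend (hs : ∀ v, 0 < s v) (k : ℕ) (c : faces X (k + 1) → ℝ) :
    boundaryOp s (weightedExtend X s (k + 1) c) = weightedExtend X s k (boundary X k c) := by
  ext τ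
  by_cases hτ : τ ∈ faces X k
  · let g : Finset V → ℝ := fun σ => if h : σ ∈ faces X (k + 1) then c ⟨σ, h⟩ else 0
    have h1 : boundary X k c ⟨τ, hτ⟩ = ∑ v, annihilate v g τ := by
      rw [← sum_incidence_mul]
      simp only [boundary, boundaryMatrix, Matrix.mulVecLin_apply, Matrix.mulVec, dotProduct,
        Matrix.of_apply]
      rw [← Finset.sum_subset (Finset.subset_univ (faces X (k + 1))),
        ← Finset.sum_coe_sort (faces X (k + 1))]
      · exact Finset.sum_congr rfl fun σ _ => by simp [g]
      · intro σ _ hσ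
        simp [g, hσ]
    rw [weightedExtend_apply k _ ⟨τ, hτ⟩, h1, boundaryOp, Finset.sum_mul]
    refine Finset.sum_congr rfl fun v _ => ?_
    unfold annihilate
    split_ifs with hv
    · simp
    · have h2 : weightedExtend X s (k + 1) c (insert v τ) =
          g (insert v τ) * (∏ u ∈ insert v τ, s u)⁻¹ := rfl
      rw [h2, Finset.prod_insert hv, mul_inv]
      have := (hs v).ne'
      field_simp
  · rw [weightedExtend_apply_of_notMem _ hτ]
    refine Finset.sum_eq_zero fun v _ => ?_
    unfold annihilate
    split_ifs with hv
    · simp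
    · rw [weightedExtend_apply_of_notMem]
      · simp
      · intro h
        rw [mem_faces, Finset.card_insert_of_notMem hv] at h
        exact hτ (mem_faces.2 ⟨h.1.mono (Finset.subset_insert _ _), by omega⟩)

/-- Here b is the orthogonal projection of c to B for the Euclidean inner product. -/
lemma exists_mem_forall_sum_sub_mul_eq_zero {ι : Type*} [Fintype ι] (B : Submodule ℝ (ι → ℝ))
    (c : ι → ℝ) : ∃ b ∈ B, ∀ b' ∈ B, ∑ i, (c i - b i) * b' i = 0 := by
  let e := WithLp.linearEquiv 2 ℝ (ι → ℝ)
  let B' : Submodule ℝ (EuclideanSpace ℝ ι) := B.comap e.toLinearMap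
  obtain ⟨b, hb, z, hz, hbz⟩ := B'.exists_add_mem_mem_orthogonal (e.symm c)
  refine ⟨e b, hb, fun b' hb' => ?_⟩
  have h := (B'.mem_orthogonal z).1 hz (e.symm b') (by simpa [B'] using hb')
  have hz' : z = e.symm c - b := by rw [hbz]; abel
  rw [hz', PiLp.inner_apply] at h
  rw [← h]
  refine Finset.sum_congr rfl fun i _ => ?_
  simp [e]

lemma boundaryOp_sub (φ ψ : Finset V → ℝ) (τ : Finset V) :
    boundaryOp s (φ - ψ) τ = boundaryOp s φ τ - boundaryOp s ψ τ := by
  rw [boundaryOp, boundaryOp, boundaryOp, ← Finset.sum_sub_distrib]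
  refine Finset.sum_congr rfl fun v _ => ?_
  unfold annihilate
  split_ifs
  · ring
  · rw [Pi.sub_apply]; ring

/-- Subtract from a rescaled non-bounding cycle its projection to the rescaled boundaries. The
difference is a nonzero cycle, and orthogonality to boundaries is, by adjointness, the vanishing of
the coboundary on X. -/
lemma exists_harmonic (hs : ∀ v, 0 < s v) {k : ℕ} (hk : Nontrivial (ReducedHomology X k)) :
    ∃ φ : Finset V → ℝ, φ ≠ 0 ∧ (∀ σ, φ σ ≠ 0 → IsSimplex X σ ∧ σ.card = k) ∧
      (∀ τ, boundaryOp s φ τ = 0) ∧ ∀ τ, IsSimplex X τ → coboundaryOp s φ τ = 0 := by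
  obtain ⟨c, hc, hcb⟩ : ∃ c ∈ cycles X k, c ∉ boundaries X k := by
    have h := Submodule.Quotient.nontrivial_iff.1 hk
    by_contra! hcon
    refine h (Submodule.eq_top_iff'.2 fun x => ?_)
    exact hcon x.1 x.2
  obtain ⟨b, hb, horth⟩ := exists_mem_forall_sum_sub_mul_eq_zero
    ((boundaries X k).map (weightedExtend X s k)) (weightedExtend X s k c)
  obtain ⟨_, ⟨d, rfl⟩, rfl⟩ := hb
  set φ : Finset V → ℝ := weightedExtend X s k c - weightedExtend X s k (boundary X k d) with hφ
  have hsupp : ∀ σ, φ σ ≠ 0 → IsSimplex X σ ∧ σ.card = k := by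
    intro σ h
    rw [← mem_faces]
    by_contra hσ
    exact h (by rw [hφ, Pi.sub_apply, weightedExtend_apply_of_notMem _ hσ,
      weightedExtend_apply_of_notMem _ hσ, sub_zero])
  refine ⟨φ, ?_, hsupp, ?_, ?_⟩
  · intro h0
    refine hcb ⟨d, ?_⟩
    exact (weightedExtend_injective hs k (sub_eq_zero.1 h0)).symm
  · intro τ
    rw [hφ, boundaryOp_sub, ← boundaryOp_weightedExtend hs k d, boundaryOp_boundaryOp, sub_zero]
    cases k with
    | zero =>
      refine Finset.sum_eq_zero fun v _ => ?_
      unfold annihilate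
      split_ifs with hv
      · simp
      · rw [weightedExtend_apply_of_notMem]
        · simp
        · simp [mem_faces]
    | succ k =>
      have : boundary X k c = 0 := hc
      rw [boundaryOp_weightedExtend hs, this, map_zero]; rfl
  · intro τ hτ
    by_cases hcard : τ.card = k + 1
    · let τ' : faces X (k + 1) := ⟨τ, mem_faces.2 ⟨hτ, hcard⟩⟩
      -- Orthogonality is tested on the boundary of the single simplex τ.
      have h := horth _ (Submodule.mem_map_of_mem ⟨Pi.single τ' 1, rfl⟩)
      have h' := sum_coboundaryOp_mul s φ (weightedExtend X s (k + 1) (Pi.single τ' 1))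
      rw [boundaryOp_weightedExtend hs] at h'
      replace h' := h'.trans h
      rw [Finset.sum_eq_single τ] at h'
      · have h2 := weightedExtend_apply (s := s) (k + 1) (Pi.single τ' 1) τ'
        rw [Pi.single_eq_same, one_mul] at h2
        rw [h2] at h'
        exact (mul_eq_zero.1 h').resolve_right
          (inv_ne_zero (Finset.prod_pos fun v _ => hs v).ne')
      · intro σ _ hσ
        by_cases hσf : σ ∈ faces X (k + 1)
        · rw [weightedExtend_apply (k + 1) _ ⟨σ, hσf⟩, Pi.single_eq_of_ne]
          · simp
          · exact fun h => hσ (congrArg Subtype.val h)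
        · rw [weightedExtend_apply_of_notMem _ hσf, mul_zero]
      · simp
    · refine Finset.sum_eq_zero fun v _ => ?_
      unfold create
      split_ifs with hv
      · have : φ (τ.erase v) = 0 := by
          by_contra h
          have h1 := (hsupp _ h).2
          have h2 := Finset.card_erase_add_one hv
          omega
        rw [this]; ring
      · ring

/-- Nontrivial reduced homology bounds the weight of a fractional packing for `P`. -/
lemma sum_weights_le (P : VectorRep X) {k : ℕ} (hk : Nontrivial (ReducedHomology X k))
    (f : V → ℝ) (hf : ∀ v, 0 < f v)
    (hP : ∀ σ ∈ repSets X, ∀ v, ∑ w, f w * inner ℝ (P.vec σ v) (P.vec σ w) ≤ 1) :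
    ∑ v, f v ≤ ((∑ r ∈ missingDims X, r * k.choose r : ℕ) : ℝ) := by
  classical
  have hsq (v : V) : √(f v) ^ 2 = f v := Real.sq_sqrt (hf v).le
  obtain ⟨φ, hφ0, hsupp, hbd, hcob⟩ :=
    exists_harmonic (X := X) (s := fun v => √(f v)) (fun v => Real.sqrt_pos.2 (hf v)) hk
  have hpos : 0 < ∑ τ, φ τ ^ 2 := by
    obtain ⟨σ, hσ⟩ := Function.ne_iff.1 hφ0
    exact Finset.sum_pos' (fun _ _ => sq_nonneg _) ⟨σ, Finset.mem_univ _, sq_pos_of_ne_zero hσ⟩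
  have hid := sum_sq_coboundaryOp_add (fun v => √(f v)) φ
  simp only [hbd, hsq] at hid
  let T : Finset (Finset V) := Finset.univ.filter fun τ => ¬ IsSimplex X τ ∧ τ.card = k + 1
  have hT : ∑ τ ∈ T, coboundaryOp (fun v => √(f v)) φ τ ^ 2 =
      ∑ τ, coboundaryOp (fun v => √(f v)) φ τ ^ 2 := by
    refine Finset.sum_subset (Finset.subset_univ _) fun τ _ hτ => ?_
    rw [sq_eq_zero_iff]
    by_cases h : IsSimplex X τ
    · exact hcob τ h
    · refine Finset.sum_eq_zero fun v _ => ?_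
      unfold create
      split_ifs with hv
      · have : φ (τ.erase v) = 0 := by
          by_contra h'
          have h1 := (hsupp _ h').2
          have h2 := Finset.card_erase_add_one hv
          exact hτ (Finset.mem_filter.2 ⟨Finset.mem_univ _, h, by omega⟩)
        rw [this]; ring
      · ring
  have hle := sum_sq_coboundaryOp_nonfaces_le P (fun v => √(f v)) φ hsupp
    (by simpa only [hsq] using hP) T fun τ hτ => (Finset.mem_filter.1 hτ).2
  rw [hT] at hle
  refine le_of_mul_le_mul_right ?_ hpos
  rw [← hid]
  simpa using hle

end Homology

/-! ### Linear programming duality -/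

/-- If no nonnegative combination of the rows of `A` of weight at most `c` dominates the all-ones
vector, then there is a positive fractional packing of weight more than `c`. -/
lemma exists_packing {ι V : Type*} [Fintype ι] [Fintype V] (A : ι → V → ℝ)
    {c : ℝ} (hc : 0 < c)
    (h : ∀ a : ι → ℝ, (∀ i, 0 ≤ a i) → (∀ w, 1 ≤ ∑ i, a i * A i w) → c < ∑ i, a i) :
    ∃ f : V → ℝ, (∀ v, 0 < f v) ∧ (∀ i, ∑ w, f w * A i w ≤ 1) ∧ c < ∑ w, f w := by
  classical
  -- By hypothesis no combination of weight at most c dominates 1, so the compact image of Q misses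
  -- the closed orthant above 1 and can be strictly separated from it.
  let Q : Set (ι → ℝ) := {a | (∀ i, 0 ≤ a i) ∧ ∑ i, a i ≤ c}
  let Φ : (ι → ℝ) →ₗ[ℝ] (V → ℝ) := Matrix.vecMulLinear (Matrix.of A)
  have hΦ (a : ι → ℝ) (w : V) : Φ a w = ∑ i, a i * A i w := rfl
  have hQclosed : IsClosed Q := by
    have h1 : IsClosed {a : ι → ℝ | ∀ i, 0 ≤ a i} := isClosed_Ici (a := (0 : ι → ℝ))
    have h2 : IsClosed {a : ι → ℝ | ∑ i, a i ≤ c} :=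
      isClosed_le (by fun_prop) continuous_const
    exact h1.inter h2
  have hQcompact : IsCompact Q := by
    refine (isCompact_Icc (a := (0 : ι → ℝ)) (b := fun _ => c)).of_isClosed_subset hQclosed ?_
    rintro a ⟨ha, hac⟩
    refine ⟨ha, fun i => le_trans ?_ hac⟩
    exact Finset.single_le_sum (fun j _ => ha j) (Finset.mem_univ i)
  have hQconvex : Convex ℝ Q := by
    rintro a ⟨ha, hac⟩ b ⟨hb, hbc⟩ x y hx hy hxy
    refine ⟨fun i => ?_, ?_⟩
    · have := ha i
      have := hb i
      simp only [Pi.add_apply, Pi.smul_apply, smul_eq_mul]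
      positivity
    · simp only [Pi.add_apply, Pi.smul_apply, smul_eq_mul, Finset.sum_add_distrib,
        ← Finset.mul_sum]
      calc _ ≤ x * c + y * c := by gcongr
        _ = c := by rw [← add_mul, hxy, one_mul]
  have hdisj : Disjoint (Φ '' Q) (Set.Ici (1 : V → ℝ)) := by
    rw [Set.disjoint_left]
    rintro _ ⟨a, ⟨ha, hac⟩, rfl⟩ hmem
    exact absurd (h a ha fun w => hmem w) (not_lt.2 hac)
  obtain ⟨g, u, t, hK, hut, hI⟩ := geometric_hahn_banach_compact_closed (hQconvex.linear_image Φ)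
    (hQcompact.image Φ.continuous_of_finiteDimensional) (convex_Ici _) isClosed_Ici hdisj
  let g' : V → ℝ := fun w => g (Pi.single w 1)
  have hg (y : V → ℝ) : g y = ∑ w, y w * g' w := by
    conv_lhs => rw [pi_eq_sum_univ' y]
    simp only [map_sum, map_smul, smul_eq_mul, g']
  have hu : 0 < u := by
    have := hK 0 ⟨0, ⟨by simp, by simpa using hc.le⟩, map_zero Φ⟩
    simpa using this
  have hg'nonneg (w : V) : 0 ≤ g' w := by
    -- A negative coordinate would make g unbounded below on the orthant.
    by_contra! hneg
    obtain ⟨n, hn⟩ := exists_nat_gt (g 1 / -g' w)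
    have h1 := hI (1 + (n : ℝ) • Pi.single w (1 : ℝ)) (by
      refine Set.mem_Ici.2 (le_add_of_nonneg_right (smul_nonneg (Nat.cast_nonneg n) ?_))
      exact Pi.single_nonneg.2 zero_le_one)
    rw [map_add, map_smul, smul_eq_mul] at h1
    rw [div_lt_iff₀ (by linarith)] at hn
    have : g (Pi.single w 1) = g' w := rfl
    nlinarith
  have hsum : u < ∑ w, g' w := by
    have := hI 1 (Set.mem_Ici.2 le_rfl)
    rw [hg] at this
    simp only [Pi.one_apply, one_mul] at this
    linarith
  have hrow (i : ι) : c * ∑ w, g' w * A i w < u := by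
    have h1 := hK (Φ (Pi.single i c)) ⟨_, ⟨fun j => ?_, ?_⟩, rfl⟩
    · rw [hg] at h1
      convert h1 using 1
      rw [Finset.mul_sum]
      refine Finset.sum_congr rfl fun w _ => ?_
      rw [hΦ, Finset.sum_eq_single i]
      · rw [Pi.single_eq_same]; ring
      · intro j _ hj; rw [Pi.single_eq_of_ne hj, zero_mul]
      · simp
    · exact (Pi.single_nonneg.2 hc.le : (0 : ι → ℝ) ≤ Pi.single i c) j
    · simp
  -- The finitely many row inequalities are strict, which leaves room to make all coordinates
  -- positive; the rescaling by vertex weights needs this.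
  have hev : ∀ᶠ ε in nhdsWithin (0 : ℝ) (Set.Ioi 0), ∀ i, c * ∑ w, (g' w + ε) * A i w < u := by
    refine nhdsWithin_le_nhds (Filter.eventually_all.2 fun i => ?_)
    have hcont : Continuous fun ε : ℝ => c * ∑ w, (g' w + ε) * A i w := by fun_prop
    exact hcont.continuousAt.eventually_lt continuousAt_const (by simpa using hrow i)
  obtain ⟨ε, hε, hε0⟩ := (hev.and self_mem_nhdsWithin).exists
  have hε0 : 0 < ε := hε0
  refine ⟨fun w => c / u * (g' w + ε), fun w => ?_, fun i => ?_, ?_⟩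
  · have := hg'nonneg w
    positivity
  · have h1 := (hε i).le
    calc ∑ w, c / u * (g' w + ε) * A i w = (c * ∑ w, (g' w + ε) * A i w) / u := by
          rw [Finset.mul_sum, Finset.sum_div]
          exact Finset.sum_congr rfl fun w _ => by ring
      _ ≤ 1 := (div_le_one hu).2 h1
  · rw [← Finset.mul_sum]
    have h2 : ∑ w, g' w ≤ ∑ w, (g' w + ε) := Finset.sum_le_sum fun w _ => by linarith
    calc c = c / u * u := by field_simp
      _ < c / u * ∑ w, (g' w + ε) := by gcongr; linarith

/-! ### From packings to the bound on Γ -/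

lemma value_le_of_nontrivial_homology {V : Type*} [Fintype V] [LinearOrder V]
    {X : AbstractSimplicialComplex V} (P : VectorRep X) {k : ℕ}
    (hk : Nontrivial (ReducedHomology X k)) :
    P.value ≤ ((∑ r ∈ missingDims X, r * k.choose r : ℕ) : ℝ≥0∞) := by
  classical
  by_contra! hlt
  obtain ⟨c, hNc, hcP⟩ := ENNReal.lt_iff_exists_nnreal_btwn.1 hlt
  have hNc' : ((∑ r ∈ missingDims X, r * k.choose r : ℕ) : ℝ) < c := by exact_mod_cast hNc
  have hc : (0 : ℝ) < c := lt_of_le_of_lt (Nat.cast_nonneg _) hNc'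
  -- Rows with σ outside `repSets X` are set to zero: they help no domination and constrain no
  -- packing.
  obtain ⟨f, hf, hrow, hsum⟩ := exists_packing
    (fun (i : Finset V × V) w => if i.1 ∈ repSets X then inner ℝ (P.vec i.1 i.2) (P.vec i.1 w)
      else 0) hc (by
    intro a ha hdom
    have hα : IsDominating P fun σ v => a (σ, v) := by
      refine ⟨fun σ _ v => ha _, fun w => (hdom w).trans (le_of_eq ?_)⟩
      rw [Fintype.sum_prod_type]
      refine (Finset.sum_subset (Finset.subset_univ (repSets X)) fun σ _ hσ => ?_).symm.trans
        (Finset.sum_congr rfl fun σ hσ => ?_)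
      · simp [hσ]
      · simp [hσ]
    have h1 : (c : ℝ≥0∞) < ENNReal.ofReal (∑ σ ∈ repSets X, ∑ v, a (σ, v)) :=
      hcP.trans_le (iInf₂_le _ hα)
    have h2 : (c : ℝ) < ∑ σ ∈ repSets X, ∑ v, a (σ, v) := by
      by_contra! hle
      have := ENNReal.ofReal_le_ofReal hle
      rw [ENNReal.ofReal_coe_nnreal] at this
      exact absurd h1 this.not_gt
    refine h2.trans_le ?_
    rw [Fintype.sum_prod_type]
    exact Finset.sum_le_sum_of_subset_of_nonneg (Finset.subset_univ _) fun σ _ _ =>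
      Finset.sum_nonneg fun v _ => ha _)
  have := sum_weights_le P hk f hf fun σ hσ v => by simpa [hσ] using hrow (σ, v)
  linarith

/-- Needed when η = ∞: the right-hand side is infinite only if its sum has a term. -/
lemma missingDims_nonempty {V : Type*} [Fintype V] [Nonempty V]
    {X : AbstractSimplicialComplex V} (hX : Finset.univ ∉ X) : (missingDims X).Nonempty := by
  have h : ¬ IsSimplex X Finset.univ := by
    rintro (h | h)
    · exact Finset.univ_nonempty.ne_empty h
    · exact hX h
  obtain ⟨M, -, hM⟩ := exists_missingFace_subset X h
  exact ⟨_, hM.card_sub_one_mem⟩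

lemma Gamma_of_isEmpty {V : Type*} [Fintype V] [DecidableEq V] [IsEmpty V]
    (X : AbstractSimplicialComplex V) : Gamma X = 0 := by
  refine le_antisymm (iSup_le fun P => ?_) zero_le
  refine (iInf₂_le (fun _ _ => 0) ⟨fun _ _ _ => le_rfl, fun w => isEmptyElim w⟩).trans ?_
  simp

end VectorDomination

end

theorem mainTheorem1 {V : Type*} [Fintype V] [LinearOrder V] (X : AbstractSimplicialComplex V)
    (hX : Finset.univ ∉ X) :
    VectorDomination.Gamma X ≤
      ((∑ r ∈ VectorDomination.missingDims X,
        (r : ℕ∞) * VectorDomination.enatChoose (VectorDomination.eta X) r : ℕ∞) : ℝ≥0∞) := by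
  classical
  -- The empty set is never a member of X, so `hX` does not exclude empty V; there the zero family
  -- dominates vacuously.
  rcases isEmpty_or_nonempty V with hV | hV
  · rw [VectorDomination.Gamma_of_isEmpty]; exact zero_le
  by_cases h : ∃ k, Nontrivial (VectorDomination.ReducedHomology X k)
  · have hη : VectorDomination.eta X = (Nat.find h : ℕ) := by
      refine le_antisymm (iInf₂_le (Nat.find h) (Nat.find_spec h)) (le_iInf₂ fun s hs => ?_)
      exact_mod_cast Nat.find_min' h hs
    refine iSup_le fun P => (VectorDomination.value_le_of_nontrivial_homology P
      (Nat.find_spec h)).trans (le_of_eq ?_)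
    have hch (n r : ℕ) : VectorDomination.enatChoose (n : ℕ∞) r = (n.choose r : ℕ) := rfl
    rw [hη]
    simp only [hch]
    rw [← ENat.toENNReal_coe]
    push_cast
    rfl
  · have hη : VectorDomination.eta X = ⊤ := by
      refine iInf₂_eq_top.2 fun s hs => (h ⟨s, hs⟩).elim
    obtain ⟨r, hr⟩ := VectorDomination.missingDims_nonempty hX
    obtain ⟨q, rfl⟩ := Nat.exists_eq_add_of_le' (VectorDomination.one_le_of_mem_missingDims hr)
    have htop : VectorDomination.enatChoose ⊤ (q + 1) = ⊤ := rfl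
    -- As r = q + 1 ≥ 1, this single summand is already infinite.
    have hle := Finset.single_le_sum (f := fun r : ℕ => (r : ℕ∞) *
      VectorDomination.enatChoose (VectorDomination.eta X) r) (fun _ _ => zero_le) hr
    rw [hη, htop, ENat.mul_top (by simp), top_le_iff] at hle
    rw [hη, hle]
    simp
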